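/- All groups are finite. A \emph{surjective group sequence of length $\ell$} is a chain of surjective homomorphisms $S_\ell \xrightarrow{\pi_\ell} S_{\ell-1} \to \cdots \to S_1 \xrightarrow{\pi_1} S_0 = 1$. Two such sequences $S_1 = ((S_{i;1}),(\pi_{i;1}))$ and $S_2 = ((S_{i;2}),(\pi_{i;2}))$ of length $\ell$ are \emph{compatible} if $\ker(\pi_{i;1}) \cong \ker(\pi_{i;2})$ for every $1 \le i \le \ell$. For $A \le \operatorname{Aut}(G)$ and $H \le G$, let $A^H := \{\sigma|_H : \sigma \in A,\ \sigma(H) = H\} \le \operatorname{Aut}(H)$, and for an isomorphism $f : G_1 \to G_2$ let $f_\bullet : \operatorname{Aut}(G_1) \to \operatorname{Aut}(G_2)$, $\alpha \mapsto f \circ \alpha \circ f^{-1}$. A homomorphism $p : G \to L$ is \emph{trivially extendable} at $N \le L$ if $p^{-1}(M) \cong M \times \ker(p)$ for every subgroup $M \le N$. Let $\ell \ge 2$ and let $S_1, S_2$ be compatible surjective group sequences of length $\ell$ with $(S_1,S_2) \in \mathbf{Comp}_\ell$, that is, for every $i$ with $2 \le i \le \ell-1$ there is an isomorphism $\sigma_i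 : \ker(\pi_{i;1}) \to \ker(\pi_{i;2})$ such that \[(\sigma_i)_\bullet\bigl(\operatorname{Inn}(S_{i;1})^{\ker(\pi_{i;1})}\bigr) \le \operatorname{Aut}(S_{i;2})^{\ker(\pi_{i;2})} \quad\text{and}\quad (\sigma_i^{-1})_\bullet\bigl(\operatorname{Inn}(S_{i;2})^{\ker(\pi_{i;2})}\bigr) \le \operatorname{Aut}(S_{i;1})^{\ker(\pi_{i;1})}\] (for $\ell = 2$ this condition is empty). Then there exists a good witness system associated with $(S_1,S_2)$: a finite group $G$ with surjective homomorphisms $p_1 : G \to S_{\ell;1}$ and $p_2 : G \to S_{\ell;2}$ such that $\ker(p_1) \cong \ker(p_2)$ and, for $\delta \in \{1,2\}$, $p_\delta$ is trivially extendable at $\ker(\pi_{\ell;\delta})$. In particular, $S_{\ell;1}$ and $S_{\ell;2}$ are compatible: there is a finite group $G$ with isomorphic normal subgroups $N_1$ and $N_2$ such that $S_{\ell;1} \cong G/N_1$ and $S_{\ell;2} \cong G/N_2$. -/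

import Mathlib

universe u

/-- Two (finite) groups `L₁`, `L₂` are compatible if some finite group `G` has isomorphic normal
subgroups `N₁`, `N₂` with `L₁ ≅ G ⧸ N₁` and `L₂ ≅ G ⧸ N₂`. -/
def CompatibleGroups (L₁ L₂ : Type u) [Group L₁] [Group L₂] : Prop :=
  ∃ (G : Type u) (_ : Group G) (_ : Finite G) (N₁ N₂ : Subgroup G) (_ : N₁.Normal)
    (_ : N₂.Normal),
    Nonempty (N₁ ≃* N₂) ∧ Nonempty (L₁ ≃* G ⧸ N₁) ∧ Nonempty (L₂ ≃* G ⧸ N₂)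

/-- A sequence `S_ℓ → ⋯ → S_1 → S_0 = 1` of finite groups and homomorphisms. The map
`S_{i+1} → S_i` is `hom i`, for `0 ≤ i < ℓ`. -/
structure GroupSequence (ℓ : ℕ) where
  obj : Fin (ℓ + 1) → Type u
  [group : ∀ i, Group (obj i)]
  [finite : ∀ i, Finite (obj i)]
  obj_zero : Subsingleton (obj 0)
  hom : ∀ i : Fin ℓ, obj i.succ →* obj i.castSucc

attribute [instance] GroupSequence.group GroupSequence.finite

namespace GroupSequence

variable {ℓ : ℕ}

/-- All the maps of the sequence are surjective. -/
def IsSurjective (S : GroupSequence.{u} ℓ) : Prop :=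
  ∀ i, Function.Surjective (S.hom i)

/-- The top group `S_ℓ`. -/
abbrev top (S : GroupSequence.{u} ℓ) : Type u := S.obj (Fin.last ℓ)

/-- The kernel of the top map `S_ℓ → S_{ℓ-1}`. (A sequence of length `0` has no top map;
there the value `⊤` is a mere convention.) -/
def topKer : {ℓ : ℕ} → (S : GroupSequence.{u} ℓ) → Subgroup S.top
  | 0, _ => ⊤
  | n + 1, S => (S.hom (Fin.last n)).ker

/-- Surjective group sequences of the same length with isomorphic kernels at each step. -/
def Compatible (S₁ S₂ : GroupSequence.{u} ℓ) : Prop :=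
  S₁.IsSurjective ∧ S₂.IsSurjective ∧
    ∀ i, Nonempty ((S₁.hom i).ker ≃* (S₂.hom i).ker)

end GroupSequence

/-- For `A ≤ Aut(G)` and `H ≤ G`, the group of all restrictions to `H` of those `σ ∈ A` with
`σ(H) = H`. -/
def restrictAut {G : Type u} [Group G] (A : Subgroup (MulAut G)) (H : Subgroup G) :
    Subgroup (MulAut H) where
  carrier := {τ | ∃ σ ∈ A, H.map σ.toMonoidHom = H ∧ ∀ h : H, ((τ h : H) : G) = σ (h : G)}
  one_mem' := ⟨1, A.one_mem, by ext; simp, fun _ => rfl⟩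
  mul_mem' := by
    rintro τ τ' ⟨σ, hσ, hH, h⟩ ⟨σ', hσ', hH', h'⟩
    refine ⟨σ * σ', A.mul_mem hσ hσ', ?_, fun x => ?_⟩
    · have : (σ * σ').toMonoidHom = σ.toMonoidHom.comp σ'.toMonoidHom := rfl
      rw [this, ← Subgroup.map_map, hH', hH]
    · rw [MulAut.mul_apply, MulAut.mul_apply, h, h']
  inv_mem' := by
    rintro τ ⟨σ, hσ, hH, h⟩
    refine ⟨σ⁻¹, A.inv_mem hσ, ?_, fun x => ?_⟩
    · have : (σ⁻¹).toMonoidHom.comp σ.toMonoidHom = MonoidHom.id G := by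
        ext x; exact σ.symm_apply_apply x
      conv_lhs => rw [← hH]
      rw [Subgroup.map_map, this, Subgroup.map_id]
    · have hx := h (τ⁻¹ x)
      rw [MulAut.apply_inv_self] at hx
      rw [hx, MulAut.inv_apply_self]

/-- The group of inner automorphisms. -/
def innAut (G : Type u) [Group G] : Subgroup (MulAut G) := (MulAut.conj (G := G)).range

/-- Pairs of compatible group sequences of length `ℓ` such that, for `2 ≤ i ≤ ℓ - 1`, some
isomorphism `σ : ker(π_{i;1}) → ker(π_{i;2})` satisfies
`σ_• (Inn(S_{i;1})^{ker π_{i;1}}) ≤ Aut(S_{i;2})^{ker π_{i;2}}` and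
`(σ⁻¹)_• (Inn(S_{i;2})^{ker π_{i;2}}) ≤ Aut(S_{i;1})^{ker π_{i;1}}`.
Since `π_{i+1}` is `hom i`, the index below runs over `1 ≤ i` with `i + 1 ≤ ℓ - 1`.
`MulAut.congr f` is the map `α ↦ f ∘ α ∘ f⁻¹`. -/
def IsComp {ℓ : ℕ} (S₁ S₂ : GroupSequence.{u} ℓ) : Prop :=
  S₁.Compatible S₂ ∧
    ∀ i : Fin ℓ, 1 ≤ (i : ℕ) → (i : ℕ) + 1 < ℓ →
      ∃ σ : (S₁.hom i).ker ≃* (S₂.hom i).ker,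
        (restrictAut (innAut (S₁.obj i.succ)) (S₁.hom i).ker).map
            (MulAut.congr σ).toMonoidHom ≤ restrictAut ⊤ (S₂.hom i).ker ∧
        (restrictAut (innAut (S₂.obj i.succ)) (S₂.hom i).ker).map
            (MulAut.congr σ.symm).toMonoidHom ≤ restrictAut ⊤ (S₁.hom i).ker

/-- `π⁻¹(M) ≅ M × ker π` for every `M ≤ N`. -/
def TriviallyExtendable {G H : Type u} [Group G] [Group H] (π : G →* H) (N : Subgroup H) :
    Prop :=
  ∀ M : Subgroup H, M ≤ N → Nonempty (M.comap π ≃* M × π.ker)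

/-- `(G, p₁, p₂)` is a witness system for the compatibility of `L₁` and `L₂`: `G` is finite and
`p₁`, `p₂` are surjective with isomorphic kernels. -/
def IsWitnessSystem {G L₁ L₂ : Type u} [Group G] [Group L₁] [Group L₂]
    (p₁ : G →* L₁) (p₂ : G →* L₂) : Prop :=
  Finite G ∧ Function.Surjective p₁ ∧ Function.Surjective p₂ ∧ Nonempty (p₁.ker ≃* p₂.ker)

/-- A witness system that is good with respect to subgroups `N₁ ≤ L₁` and `N₂ ≤ L₂`. -/
def IsGoodWitnessSystem {G L₁ L₂ : Type u} [Group G] [Group L₁] [Group L₂]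
    (p₁ : G →* L₁) (p₂ : G →* L₂) (N₁ : Subgroup L₁) (N₂ : Subgroup L₂) : Prop :=
  IsWitnessSystem p₁ p₂ ∧ TriviallyExtendable p₁ N₁ ∧ TriviallyExtendable p₂ N₂

/-- A good witness system associated with a pair of group sequences. -/
def GroupSequence.IsGoodWitnessSystem {ℓ : ℕ} (S₁ S₂ : GroupSequence.{u} ℓ) {G : Type u}
    [Group G] (p₁ : G →* S₁.top) (p₂ : G →* S₂.top) : Prop :=
  _root_.IsGoodWitnessSystem p₁ p₂ S₁.topKer S₂.topKer

/-!
Given extensions `E_δ → S_{j;δ}` (`δ = 1, 2`) with isomorphic kernels, good witness systems for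
`E_1` and `E_2` with respect to these kernels are found by induction on `j ≥ 1`; the theorem is the
case `E_δ = S_{ℓ;δ}`, `j = ℓ - 1`. For `j = 1` the groups `S_{1;1}` and `S_{1;2}` are isomorphic,
and the fibre product of `E_1` and `E_2` is a good witness system. For larger `j`, set
`L_δ = S_{j;δ}` and `K_δ = ker π_{j;δ}`, and let `D_1 → L_1` be the fibre product over `L_1` of

* the twists of `E_1` by automorphisms of `L_1` that extend, via `σ : K_1 ≃* K_2`, the conjugations
  of `K_2` by representatives of the cosets of `K_2` in `L_2`;
* the pullback of the wreath product of `E_2` by `L_1` along the monomial embedding of `L_1` into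
  the wreath product of `K_1` by `L_1`, with respect to representatives of the cosets of `K_1`.

Over `K_1`, the second factor is the fibre product of the twists of `E_2` by the conjugations by the
representatives. Hence `D_1` and the symmetrically defined `D_2` become isomorphic over
`K_1 ≃* K_2`: both are the fibre product of all these twists. So `D_1` and `D_2`, as extensions of
`S_{j-1;1}` and `S_{j-1;2}`, have isomorphic kernels, and a good witness system for `D_1` and `D_2`
yields one for `E_1` and `E_2`.
-/

section TriviallyExtendable

variable {G H L : Type u} [Group G] [Group H] [Group L]

theorem TriviallyExtendable.of_section (p : G →* H) (N : Subgroup H) (s : N →* G)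
    (hs : ∀ n, p (s n) = n) (hc : ∀ n, ∀ x ∈ p.ker, Commute (s n) x) :
    TriviallyExtendable p N := fun M hM => by
  let i : M →* G := s.comp (Subgroup.inclusion hM)
  let φ : M × p.ker →* G := i.noncommCoprod p.ker.subtype fun _ x => hc _ _ x.2
  have hi (m : M) : p (i m) = m := hs _
  have hφ (y : M × p.ker) : p (φ y) = y.1 := by
    simp only [φ, MonoidHom.noncommCoprod_apply, Subgroup.coe_subtype, map_mul, hi,
      MonoidHom.mem_ker.1 y.2.2, mul_one]
  exact ⟨MulEquiv.symm {
    toFun y := ⟨φ y, by rw [Subgroup.mem_comap, hφ]; exact y.1.2⟩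
    invFun g := (⟨p g, g.2⟩, ⟨(i ⟨p g, g.2⟩)⁻¹ * g, by
      rw [MonoidHom.mem_ker, map_mul, map_inv, hi, inv_mul_cancel]⟩)
    left_inv y := by
      have hy : (⟨p (φ y), by rw [hφ]; exact y.1.2⟩ : M) = y.1 := Subtype.ext (hφ y)
      simp only [hy]
      exact Prod.ext rfl (Subtype.ext (inv_mul_cancel_left (i y.1) y.2))
    right_inv g := Subtype.ext (mul_inv_cancel_left (i ⟨p g, g.2⟩) g)
    map_mul' y z := Subtype.ext (map_mul φ y z) }⟩

theorem TriviallyExtendable.nonempty_ker_comp_equiv {p : G →* H} {B : Subgroup H}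
    (hp : TriviallyExtendable p B) (r : H →* L) (hr : r.ker ≤ B) :
    Nonempty ((r.comp p).ker ≃* r.ker × p.ker) :=
  hp r.ker hr

theorem TriviallyExtendable.comp {p : G →* H} {B : Subgroup H} (hp : TriviallyExtendable p B)
    {r : H →* L} {N : Subgroup L} (hr : TriviallyExtendable r N) (hN : N.comap r ≤ B) :
    TriviallyExtendable (r.comp p) N := fun M hM => by
  have hMB : M.comap r ≤ B := (Subgroup.comap_mono hM).trans hN
  obtain ⟨preimage⟩ := hp _ hMB
  obtain ⟨preimage'⟩ := hr M hM
  obtain ⟨kernel⟩ := hp.nonempty_ker_comp_equiv r ((r.ker_le_comap M).trans hMB)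
  exact ⟨preimage.trans ((preimage'.prodCongr (.refl _)).trans (MulEquiv.prodAssoc.trans
    ((MulEquiv.refl _).prodCongr kernel.symm)))⟩

end TriviallyExtendable

theorem IsWitnessSystem.compatibleGroups {G L₁ L₂ : Type u} [Group G] [Group L₁] [Group L₂]
    {p₁ : G →* L₁} {p₂ : G →* L₂} (h : IsWitnessSystem p₁ p₂) : CompatibleGroups L₁ L₂ := by
  obtain ⟨hG, h₁, h₂, e⟩ := h
  exact ⟨G, _, hG, p₁.ker, p₂.ker, inferInstance, inferInstance, e,
    ⟨(QuotientGroup.quotientKerEquivOfSurjective p₁ h₁).symm⟩,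
    ⟨(QuotientGroup.quotientKerEquivOfSurjective p₂ h₂).symm⟩⟩

theorem IsGoodWitnessSystem.comp {G D₁ D₂ E₁ E₂ : Type u} [Group G] [Group D₁] [Group D₂]
    [Group E₁] [Group E₂] {p₁ : G →* D₁} {p₂ : G →* D₂} {B₁ : Subgroup D₁} {B₂ : Subgroup D₂}
    (h : IsGoodWitnessSystem p₁ p₂ B₁ B₂) {r₁ : D₁ →* E₁} {r₂ : D₂ →* E₂}
    (hr₁ : Function.Surjective r₁) (hr₂ : Function.Surjective r₂)
    (hker : Nonempty (r₁.ker ≃* r₂.ker)) {N₁ : Subgroup E₁} {N₂ : Subgroup E₂}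
    (h₁ : TriviallyExtendable r₁ N₁) (h₂ : TriviallyExtendable r₂ N₂)
    (hN₁ : N₁.comap r₁ ≤ B₁) (hN₂ : N₂.comap r₂ ≤ B₂) :
    IsGoodWitnessSystem (r₁.comp p₁) (r₂.comp p₂) N₁ N₂ := by
  obtain ⟨⟨hG, s₁, s₂, ⟨e⟩⟩, t₁, t₂⟩ := h
  obtain ⟨k⟩ := hker
  obtain ⟨a₁⟩ := t₁.nonempty_ker_comp_equiv r₁ ((r₁.ker_le_comap N₁).trans hN₁)
  obtain ⟨a₂⟩ := t₂.nonempty_ker_comp_equiv r₂ ((r₂.ker_le_comap N₂).trans hN₂)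
  exact ⟨⟨hG, hr₁.comp s₁, hr₂.comp s₂, ⟨a₁.trans ((k.prodCongr e).trans a₂.symm)⟩⟩,
    t₁.comp h₁ hN₁, t₂.comp h₂ hN₂⟩

section FibreProduct

variable {E₁ E₂ Q : Type u} [Group E₁] [Group E₂] [Group Q]

/-- The fibre product `E₁ ×_Q E₂` of two homomorphisms to `Q`. -/
def fibreProduct (π₁ : E₁ →* Q) (π₂ : E₂ →* Q) : Subgroup (E₁ × E₂) :=
  (π₁.comp (.fst E₁ E₂)).eqLocus (π₂.comp (.snd E₁ E₂))

namespace fibreProduct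

variable (π₁ : E₁ →* Q) (π₂ : E₂ →* Q)

/-- The projection of the fibre product to its first factor. -/
def fst : fibreProduct π₁ π₂ →* E₁ :=
  (MonoidHom.fst E₁ E₂).comp (fibreProduct π₁ π₂).subtype

/-- The projection of the fibre product to its second factor. -/
def snd : fibreProduct π₁ π₂ →* E₂ :=
  (MonoidHom.snd E₁ E₂).comp (fibreProduct π₁ π₂).subtype

variable {π₁ π₂}

theorem fst_surjective (h₂ : Function.Surjective π₂) : Function.Surjective (fst π₁ π₂) := fun x =>
  have ⟨y, hy⟩ := h₂ (π₁ x)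
  ⟨⟨(x, y), hy.symm⟩, rfl⟩

theorem snd_surjective (h₁ : Function.Surjective π₁) : Function.Surjective (snd π₁ π₂) := fun y =>
  have ⟨x, hx⟩ := h₁ (π₂ y)
  ⟨⟨(x, y), hx⟩, rfl⟩

/-- Base change of the kernel along `π₁`. -/
def kerFstEquiv : (fst π₁ π₂).ker ≃* π₂.ker where
  toFun x := ⟨x.1.1.2, x.1.2.symm.trans ((congrArg π₁ x.2).trans (map_one π₁))⟩
  invFun y := ⟨⟨(1, y), (map_one π₁).trans y.2.symm⟩, rfl⟩
  left_inv x := Subtype.ext (Subtype.ext (Prod.ext x.2.symm rfl))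
  map_mul' _ _ := rfl

/-- Base change of the kernel along `π₂`. -/
def kerSndEquiv : (snd π₁ π₂).ker ≃* π₁.ker where
  toFun x := ⟨x.1.1.1, x.1.2.trans ((congrArg π₂ x.2).trans (map_one π₂))⟩
  invFun y := ⟨⟨(y, 1), y.2.trans (map_one π₂).symm⟩, rfl⟩
  left_inv x := Subtype.ext (Subtype.ext (Prod.ext rfl x.2.symm))
  map_mul' _ _ := rfl

theorem triviallyExtendable_fst : TriviallyExtendable (fst π₁ π₂) π₁.ker :=
  .of_section _ _ (((MonoidHom.inl E₁ E₂).comp π₁.ker.subtype).codRestrict _ fun x =>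
      x.2.trans (map_one π₂).symm) (fun _ => rfl) fun n x (hx : x.1.1 = 1) =>
    Subtype.ext (Prod.ext (hx.symm ▸ Commute.one_right n.1 : Commute n.1 x.1.1)
      (Commute.one_left x.1.2))

theorem triviallyExtendable_snd : TriviallyExtendable (snd π₁ π₂) π₂.ker :=
  .of_section _ _ (((MonoidHom.inr E₁ E₂).comp π₂.ker.subtype).codRestrict _ fun x =>
      (map_one π₁).trans x.2.symm) (fun _ => rfl) fun n x (hx : x.1.2 = 1) =>
    Subtype.ext (Prod.ext (Commute.one_left x.1.1)
      (hx.symm ▸ Commute.one_right n.1 : Commute n.1 x.1.2))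

theorem isGoodWitnessSystem [Finite E₁] [Finite E₂] (h₁ : Function.Surjective π₁)
    (h₂ : Function.Surjective π₂) (e : π₁.ker ≃* π₂.ker) :
    IsGoodWitnessSystem (fst π₁ π₂) (snd π₁ π₂) π₁.ker π₂.ker :=
  ⟨⟨inferInstance, fst_surjective h₂, snd_surjective h₁,
    ⟨kerFstEquiv.trans (e.symm.trans kerSndEquiv.symm)⟩⟩,
    triviallyExtendable_fst, triviallyExtendable_snd⟩

end fibreProduct

end FibreProduct

section CosetCocycle

variable {L : Type*} [Group L] (K : Subgroup L)

theorem cosetCocycle_mem (l : L) (q : L ⧸ K) : q.out⁻¹ * l * (l⁻¹ • q).out ∈ K := by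
  rw [mul_assoc, ← QuotientGroup.eq, QuotientGroup.out_eq', ← smul_eq_mul,
    MulAction.Quotient.mk_smul_out, smul_inv_smul]

/-- The cocycle of the monomial embedding `l ↦ (cosetCocycle K l, l)` of `L` into
`(L ⧸ K → K) ⋊ L`, with respect to the coset representatives `Quotient.out`. -/
noncomputable def cosetCocycle (l : L) (q : L ⧸ K) : K :=
  ⟨q.out⁻¹ * l * (l⁻¹ • q).out, cosetCocycle_mem K l q⟩

theorem cosetCocycle_one (q : L ⧸ K) : cosetCocycle K 1 q = 1 :=
  Subtype.ext (by simp [cosetCocycle])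

theorem cosetCocycle_mul (l m : L) (q : L ⧸ K) :
    cosetCocycle K (l * m) q = cosetCocycle K l q * cosetCocycle K m (l⁻¹ • q) :=
  Subtype.ext (by simp [cosetCocycle, mul_smul, mul_assoc])

theorem cosetCocycle_inv (l : L) (q : L ⧸ K) :
    cosetCocycle K l⁻¹ q = (cosetCocycle K l (l • q))⁻¹ :=
  Subtype.ext (by simp [cosetCocycle, mul_assoc])

variable {K}

theorem inv_smul_quotient_of_mem [K.Normal] {k : L} (hk : k ∈ K) (q : L ⧸ K) : k⁻¹ • q = q := by
  rw [← MulAction.Quotient.coe_smul_out, smul_eq_mul, QuotientGroup.mk_mul,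
    (QuotientGroup.eq_one_iff _).2 (K.inv_mem hk), one_mul, QuotientGroup.out_eq']

theorem cosetCocycle_coe [K.Normal] (k : K) (q : L ⧸ K) :
    cosetCocycle K k q = MulAut.conjNormal q.out⁻¹ k :=
  Subtype.ext (by simp [cosetCocycle, inv_smul_quotient_of_mem k.2])

end CosetCocycle

section LiftsConj

variable {L L' : Type u} [Group L] [Group L'] {K' : Subgroup L'} {K : Subgroup L}

/-- The automorphism `α t` of `L` extends the automorphism of `K` that corresponds under `σ` to the
conjugation of `K'` by the inverse of the representative of the coset `t`. The conjugation is
expressed by the cocycle, see `cosetCocycle_coe`. -/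
def LiftsConj (σ : K ≃* K') (α : L' ⧸ K' → MulAut L) : Prop :=
  ∀ t, ∀ k : K, α t k = σ.symm (cosetCocycle K' (σ k) t)

theorem LiftsConj.apply_mem_iff [K'.Normal] {σ : K ≃* K'} {α : L' ⧸ K' → MulAut L}
    (hα : LiftsConj σ α) {t : L' ⧸ K'} {l : L} : α t l ∈ K ↔ l ∈ K := by
  refine ⟨fun h => ?_, fun h => hα t ⟨l, h⟩ ▸ Subtype.prop _⟩
  let k : K := σ.symm (MulAut.conjNormal t.out (σ ⟨α t l, h⟩))
  have hk : α t k = α t l := by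
    rw [hα, cosetCocycle_coe]
    simp [k]
  exact (α t).injective hk ▸ k.2

theorem conjNormal_mem_restrictAut [K.Normal] (l : L) :
    MulAut.conjNormal l ∈ restrictAut (innAut L) K :=
  ⟨MulAut.conj l, ⟨l, rfl⟩, Subgroup.Normal.map_conj_eq K l, fun _ => rfl⟩

theorem exists_liftsConj [K'.Normal] (σ : K ≃* K')
    (h : (restrictAut (innAut L') K').map (MulAut.congr σ.symm).toMonoidHom ≤ restrictAut ⊤ K) :
    ∃ α, LiftsConj σ α := by
  choose α _ _ hα using fun t : L' ⧸ K' =>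
    h (Subgroup.mem_map_of_mem _ (conjNormal_mem_restrictAut t.out⁻¹))
  exact ⟨α, fun t k => by rw [cosetCocycle_coe]; exact (hα t k).symm⟩

end LiftsConj

section ExchangeCoordinates

variable {I J A B : Type*} [Group A] [Group B]

/-- The subgroup of `A ^ I × B ^ J` where the coordinate at `j` is trivial. -/
def trivialAt (I A B : Type*) [Group A] [Group B] {J : Type*} (j : J) :
    Subgroup ((I → A) × (J → B)) :=
  ((Pi.evalMonoidHom (fun _ => B) j).comp (.snd _ _)).ker

theorem mem_trivialAt {j : J} {x : (I → A) × (J → B)} : x ∈ trivialAt I A B j ↔ x.2 j = 1 :=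
  Iff.rfl

open Classical in
/-- The isomorphism `A ^ I × B ^ (J ∖ j) ≃ B ^ J × A ^ (I ∖ i)` that moves the coordinate at `i` to
`j`. -/
noncomputable def exchangeEquiv (ν : A ≃* B) (i : I) (j : J) :
    trivialAt I A B j ≃* trivialAt J B A i where
  toFun x := ⟨(Function.update x.1.2 j (ν (x.1.1 i)), Function.update x.1.1 i 1),
    mem_trivialAt.2 (Function.update_self i 1 _)⟩
  invFun y := ⟨(Function.update y.1.2 i (ν.symm (y.1.1 j)), Function.update y.1.1 j 1),
    mem_trivialAt.2 (Function.update_self j 1 _)⟩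
  left_inv x := by
    ext <;> simp [← mem_trivialAt.1 x.2]
  right_inv y := by
    ext <;> simp [← mem_trivialAt.1 y.2]
  map_mul' x y := Subtype.ext <| Prod.ext
    (by simp [← Function.update_mul])
    (by simp [← Function.update_mul])

end ExchangeCoordinates

section MulAutArrow

variable {G X A : Type*} [Group G] [MulAction G X] [Group A]

theorem mul_left_mulAutArrow_apply (x y : (X → A) ⋊[mulAutArrow] G) (a : X) :
    (x * y).left a = x.left a * y.left (x.right⁻¹ • a) := rfl

theorem inv_left_mulAutArrow_apply (x : (X → A) ⋊[mulAutArrow] G) (a : X) :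
    x⁻¹.left a = (x.left (x.right • a))⁻¹ := by
  rw [SemidirectProduct.inv_left]
  change (x.left (x.right⁻¹⁻¹ • a))⁻¹ = _
  rw [inv_inv]

end MulAutArrow

section MonomialCover

variable {L L' E E' : Type u} [Group L] [Group L'] [Group E] [Group E']
  {K' : Subgroup L'} {K : Subgroup L}

/-- Let `E` and `E'` be extensions of `L` and `L'`, let `σ : K ≃* K'` be an isomorphism between
subgroups of `L` and `L'`, and let `α` be a family of automorphisms of `L`. This is the fibre
product over `L` of the twists of `E` by the `α t` and of the pullback of
`(L ⧸ K → E') ⋊ L → (L ⧸ K → L') ⋊ L` along the monomial embedding of `L` into `(L ⧸ K → K) ⋊ L`,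
where `K` is viewed as a subgroup of `L'` by `σ`. -/
def monomialCover (π : E →* L) (ϖ : E' →* L') (σ : K ≃* K') (α : L' ⧸ K' → MulAut L) :
    Subgroup (((L ⧸ K → E') ⋊[mulAutArrow] L) × (L' ⧸ K' → E)) where
  carrier := {x | (∀ q, ϖ (x.1.left q) = σ (cosetCocycle K x.1.right q)) ∧
    ∀ t, π (x.2 t) = α t x.1.right}
  one_mem' := by simp [cosetCocycle_one]
  mul_mem' := by
    rintro x y ⟨hx, hx'⟩ ⟨hy, hy'⟩
    refine ⟨fun q => ?_, by simp [hx', hy']⟩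
    rw [Prod.fst_mul, mul_left_mulAutArrow_apply, map_mul, hx, hy, SemidirectProduct.mul_right,
      cosetCocycle_mul, map_mul, Subgroup.coe_mul]
  inv_mem' := by
    rintro x ⟨hx, hx'⟩
    refine ⟨fun q => ?_, by simp [hx']⟩
    rw [Prod.fst_inv, inv_left_mulAutArrow_apply, map_inv, hx, SemidirectProduct.inv_right,
      cosetCocycle_inv, map_inv, Subgroup.coe_inv]

namespace monomialCover

instance {π : E →* L} {ϖ : E' →* L'} {σ : K ≃* K'} {α : L' ⧸ K' → MulAut L} [Finite L]
    [Finite L'] [Finite E] [Finite E'] : Finite (monomialCover π ϖ σ α) :=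
  have : Finite ((L ⧸ K → E') ⋊[mulAutArrow] L) := .of_equiv _ SemidirectProduct.equivProd.symm
  inferInstance

variable (π : E →* L) (ϖ : E' →* L') (σ : K ≃* K') (α : L' ⧸ K' → MulAut L)

/-- The homomorphism to `L` over which the cover is a fibre product. -/
def base : monomialCover π ϖ σ α →* L :=
  (SemidirectProduct.rightHom.comp (.fst _ _)).comp (monomialCover π ϖ σ α).subtype

/-- The projection of the cover to the twist of `E` by `α t`. -/
def proj (t : L' ⧸ K') : monomialCover π ϖ σ α →* E :=
  ((Pi.evalMonoidHom _ t).comp (.snd _ _)).comp (monomialCover π ϖ σ α).subtype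

variable {π ϖ σ α}

theorem ext {x y : monomialCover π ϖ σ α} (left : ∀ q, x.1.1.left q = y.1.1.left q)
    (base_eq : base π ϖ σ α x = base π ϖ σ α y)
    (proj_eq : ∀ t, proj π ϖ σ α t x = proj π ϖ σ α t y) : x = y :=
  Subtype.ext (Prod.ext (SemidirectProduct.ext (funext left) base_eq) (funext proj_eq))

theorem map_left (x : monomialCover π ϖ σ α) (q : L ⧸ K) :
    ϖ (x.1.1.left q) = σ (cosetCocycle K (base π ϖ σ α x) q) :=
  x.2.1 q

theorem map_proj (t : L' ⧸ K') (x : monomialCover π ϖ σ α) :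
    π (proj π ϖ σ α t x) = α t (base π ϖ σ α x) :=
  x.2.2 t

theorem mul_left_of_base_mem [K.Normal] {x y : monomialCover π ϖ σ α}
    (hx : base π ϖ σ α x ∈ K) (q : L ⧸ K) :
    (x * y).1.1.left q = x.1.1.left q * y.1.1.left q :=
  (mul_left_mulAutArrow_apply ..).trans <|
    congrArg (fun q' => x.1.1.left q * y.1.1.left q') (inv_smul_quotient_of_mem hx q)

theorem ker_proj_le_ker_base (t : L' ⧸ K') : (proj π ϖ σ α t).ker ≤ (base π ϖ σ α).ker :=
  fun x hx => (α t).map_eq_one_iff.1 <| by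
    rw [← map_proj, MonoidHom.mem_ker.1 hx, map_one]

theorem proj_surjective (hπ : Function.Surjective π) (hϖ : Function.Surjective ϖ)
    (t : L' ⧸ K') : Function.Surjective (proj π ϖ σ α t) := fun e => by
  classical
  let l := (α t).symm (π e)
  choose f hf using fun q => hϖ (σ (cosetCocycle K l q))
  choose g hg using fun s => hπ (α s l)
  refine ⟨⟨(⟨f, l⟩, Function.update g t e), hf, fun s => ?_⟩, Function.update_self ..⟩
  obtain rfl | hs := eq_or_ne s t
  · simp [l]
  · simp [hs, hg]

variable (π ϖ σ α) in
/-- The embedding of the kernels of the extensions into the cover. -/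
def ofKer : (L ⧸ K → ϖ.ker) × (L' ⧸ K' → π.ker) →* monomialCover π ϖ σ α :=
  ((SemidirectProduct.inl.comp (ϖ.ker.subtype.compLeft _)).prodMap
      (π.ker.subtype.compLeft _)).codRestrict _ fun x =>
    ⟨fun q => by simp [cosetCocycle_one, MonoidHom.mem_ker.1 (x.1 q).2],
      fun t => by simp [MonoidHom.mem_ker.1 (x.2 t).2]⟩

theorem ofKer_injective : Function.Injective (ofKer π ϖ σ α) := fun _ _ h =>
  Prod.ext
    (funext fun q => Subtype.ext (congrArg (fun z => z.1.1.left q) h))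
    (funext fun t => Subtype.ext (congrArg (proj π ϖ σ α t) h))

theorem ker_base_le_range_ofKer : (base π ϖ σ α).ker ≤ (ofKer π ϖ σ α).range := fun x hx => by
  have hx : base π ϖ σ α x = 1 := hx
  refine ⟨(fun q => ⟨x.1.1.left q, ?_⟩, fun t => ⟨proj π ϖ σ α t x, ?_⟩),
    ext (fun _ => rfl) hx.symm fun _ => rfl⟩
  · rw [MonoidHom.mem_ker, map_left, hx, cosetCocycle_one, map_one, Subgroup.coe_one]
  · rw [MonoidHom.mem_ker, map_proj, hx, map_one]

theorem comap_ofKer_ker_proj (t : L' ⧸ K') :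
    (proj π ϖ σ α t).ker.comap (ofKer π ϖ σ α) = trivialAt (L ⧸ K) ϖ.ker π.ker t :=
  Subgroup.ext fun x => OneMemClass.coe_eq_one (x := x.2 t)

variable (π ϖ σ α) in
/-- The kernel of a projection in coordinates. -/
noncomputable def kerProjEquiv (t : L' ⧸ K') :
    trivialAt (L ⧸ K) ϖ.ker π.ker t ≃* (proj π ϖ σ α t).ker :=
  ((trivialAt _ _ _ t).equivMapOfInjective _ ofKer_injective).trans <| .subgroupCongr <| by
    rw [← comap_ofKer_ker_proj, Subgroup.map_comap_eq_self]
    exact (ker_proj_le_ker_base t).trans ker_base_le_range_ofKer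

theorem nonempty_ker_proj_equiv (ν : π.ker ≃* ϖ.ker) {β : L ⧸ K → MulAut L'} (t : L' ⧸ K')
    (q : L ⧸ K) : Nonempty ((proj π ϖ σ α t).ker ≃* (proj ϖ π σ.symm β q).ker) :=
  ⟨(kerProjEquiv π ϖ σ α t).symm.trans
    ((exchangeEquiv ν.symm q t).trans (kerProjEquiv ϖ π σ.symm β q))⟩

theorem triviallyExtendable_proj (t : L' ⧸ K') : TriviallyExtendable (proj π ϖ σ α t) π.ker := by
  classical
  refine .of_section _ _
    ((ofKer π ϖ σ α).comp ((MonoidHom.inr _ _).comp (.mulSingle (fun _ => π.ker) t)))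
    (fun n => congrArg Subtype.val (?_ : (Pi.mulSingle t n : L' ⧸ K' → π.ker) t = n))
    fun n x hx => ?_
  · exact Pi.mulSingle_eq_same (M := fun _ => π.ker) t n
  obtain ⟨⟨f, g⟩, rfl⟩ := ker_base_le_range_ofKer (ker_proj_le_ker_base t hx)
  have hg : g t = 1 := Subtype.ext hx
  have hn : Commute (Pi.mulSingle t n) g := funext fun s => by
    obtain rfl | hs := eq_or_ne s t
    · simp [hg]
    · simp [hs]
  exact Commute.map (Prod.ext (Commute.one_left f) hn : Commute (1, Pi.mulSingle t n) (f, g))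
    (ofKer π ϖ σ α)

theorem comap_comp_proj [K'.Normal] (hα : LiftsConj σ α) (t : L' ⧸ K') :
    K.comap (π.comp (proj π ϖ σ α t)) = K.comap (base π ϖ σ α) :=
  Subgroup.ext fun x => by
    rw [Subgroup.mem_comap, MonoidHom.comp_apply, map_proj, hα.apply_mem_iff, Subgroup.mem_comap]

section Swap

variable {β : L ⧸ K → MulAut L'} [K'.Normal] [K.Normal]

/-- Over `K ≃* K'`, the cover does not change if the two extensions are swapped. -/
def swap (hα : LiftsConj σ α) (hβ : LiftsConj σ.symm β) :
    K.comap (base π ϖ σ α) →* K'.comap (base ϖ π σ.symm β) :=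
  MonoidHom.mk'
    (fun x => ⟨⟨(⟨x.1.1.2, σ ⟨_, x.2⟩⟩, x.1.1.1.left),
      fun t => (map_proj t x.1).trans (hα t ⟨_, x.2⟩),
      fun q => (map_left x.1 q).trans <| by
        rw [hβ, σ.symm_symm, σ.symm_apply_apply]⟩, (σ _).2⟩)
    fun x y => by
      refine Subtype.ext (ext (fun t => ?_) ?_ fun q => ?_)
      · exact .symm <| mul_left_of_base_mem (K := K') (σ ⟨_, x.2⟩).2 t
      · exact congrArg Subtype.val (map_mul σ ⟨_, x.2⟩ ⟨_, y.2⟩)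
      · exact mul_left_of_base_mem x.2 q

theorem nonempty_comap_comp_proj_equiv (hα : LiftsConj σ α) (hβ : LiftsConj σ.symm β)
    (t : L' ⧸ K') (q : L ⧸ K) : Nonempty (K.comap (π.comp (proj π ϖ σ α t)) ≃*
      K'.comap (ϖ.comp (proj ϖ π σ.symm β q))) := by
  rw [comap_comp_proj hα, comap_comp_proj hβ]
  exact ⟨MonoidHom.toMulEquiv (swap hα hβ) (swap hβ hα)
    (MonoidHom.ext fun x => Subtype.ext (ext (fun _ => rfl)
      (congrArg Subtype.val (σ.symm_apply_apply ⟨_, x.2⟩)) fun _ => rfl))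
    (MonoidHom.ext fun x => Subtype.ext (ext (fun _ => rfl)
      (congrArg Subtype.val (σ.apply_symm_apply ⟨_, x.2⟩)) fun _ => rfl))⟩

end Swap

end monomialCover

end MonomialCover

namespace GroupSequence

variable {n : ℕ}

theorem ker_hom_zero (S : GroupSequence.{u} (n + 1)) : (S.hom 0).ker = ⊤ :=
  eq_top_iff.2 fun _ _ => S.obj_zero.elim _ _

theorem Compatible.nonempty_obj_one_equiv {S₁ S₂ : GroupSequence.{u} (n + 1)}
    (h : S₁.Compatible S₂) :
    Nonempty (S₁.obj (0 : Fin (n + 1)).succ ≃* S₂.obj (0 : Fin (n + 1)).succ) := by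
  obtain ⟨e⟩ := h.2.2 0
  rw [ker_hom_zero, ker_hom_zero] at e
  exact ⟨Subgroup.topEquiv.symm.trans (e.trans Subgroup.topEquiv)⟩

end GroupSequence

theorem exists_isGoodWitnessSystem_of_equiv {E₁ E₂ L₁ L₂ : Type u} [Group E₁] [Group E₂]
    [Group L₁] [Group L₂] [Finite E₁] [Finite E₂] {π₁ : E₁ →* L₁} {π₂ : E₂ →* L₂}
    (hπ₁ : Function.Surjective π₁) (hπ₂ : Function.Surjective π₂) (ν : π₁.ker ≃* π₂.ker)
    (θ : L₁ ≃* L₂) :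
    ∃ (G : Type u) (_ : Group G) (p₁ : G →* E₁) (p₂ : G →* E₂),
      IsGoodWitnessSystem p₁ p₂ π₁.ker π₂.ker := by
  have hker := π₁.ker_mulEquiv_comp θ
  have hG := fibreProduct.isGoodWitnessSystem (θ.surjective.comp hπ₁ :
    Function.Surjective (θ.toMonoidHom.comp π₁)) hπ₂ ((MulEquiv.subgroupCongr hker).trans ν)
  exact ⟨_, _, _, _, hker ▸ hG⟩

theorem IsComp.exists_isGoodWitnessSystem {n : ℕ} {S₁ S₂ : GroupSequence.{u} (n + 2)}
    (h : IsComp S₁ S₂) (j : Fin (n + 1)) {E₁ E₂ : Type u} [Group E₁] [Group E₂] [Finite E₁]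
    [Finite E₂] {π₁ : E₁ →* S₁.obj j.castSucc.succ} {π₂ : E₂ →* S₂.obj j.castSucc.succ}
    (hπ₁ : Function.Surjective π₁) (hπ₂ : Function.Surjective π₂) (ν : π₁.ker ≃* π₂.ker) :
    ∃ (G : Type u) (_ : Group G) (p₁ : G →* E₁) (p₂ : G →* E₂),
      IsGoodWitnessSystem p₁ p₂ π₁.ker π₂.ker := by
  induction j using Fin.induction generalizing E₁ E₂ with
  | zero =>
    obtain ⟨θ⟩ := h.1.nonempty_obj_one_equiv
    exact exists_isGoodWitnessSystem_of_equiv hπ₁ hπ₂ ν θ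
  | succ j ih =>
    let i : Fin (n + 2) := j.succ.castSucc
    obtain ⟨σ, h₁, h₂⟩ := h.2 i (Nat.succ_pos _) (Nat.succ_lt_succ j.succ.isLt)
    obtain ⟨α, hα⟩ := exists_liftsConj σ h₂
    obtain ⟨β, hβ⟩ := exists_liftsConj σ.symm h₁
    let r₁ := monomialCover.proj π₁ π₂ σ α 1
    let r₂ := monomialCover.proj π₂ π₁ σ.symm β 1
    have hr₁ : Function.Surjective r₁ := monomialCover.proj_surjective hπ₁ hπ₂ 1
    have hr₂ : Function.Surjective r₂ := monomialCover.proj_surjective hπ₂ hπ₁ 1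
    obtain ⟨e⟩ := monomialCover.nonempty_comap_comp_proj_equiv (π := π₁) (ϖ := π₂) hα hβ 1 1
    obtain ⟨G, _, p₁, p₂, hG⟩ := ih (π₁ := (S₁.hom i).comp (π₁.comp r₁))
      (π₂ := (S₂.hom i).comp (π₂.comp r₂)) ((h.1.1 i).comp (hπ₁.comp hr₁))
      ((h.1.2.1 i).comp (hπ₂.comp hr₂)) e
    exact ⟨G, _, _, _, hG.comp hr₁ hr₂ (monomialCover.nonempty_ker_proj_equiv ν 1 1)
      (monomialCover.triviallyExtendable_proj 1) (monomialCover.triviallyExtendable_proj 1)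
      ((π₁.comp r₁).ker_le_comap (S₁.hom i).ker) ((π₂.comp r₂).ker_le_comap (S₂.hom i).ker)⟩

theorem theorem5 (ℓ : ℕ) (hℓ : 2 ≤ ℓ) (S₁ S₂ : GroupSequence.{u} ℓ) (h : IsComp S₁ S₂) :
    (∃ (G : Type u) (_ : Group G) (p₁ : G →* S₁.top) (p₂ : G →* S₂.top),
      GroupSequence.IsGoodWitnessSystem S₁ S₂ p₁ p₂) ∧
    CompatibleGroups S₁.top S₂.top := by
  obtain ⟨n, rfl⟩ := Nat.exists_eq_add_of_le' hℓ
  obtain ⟨ν⟩ := h.1.2.2 (Fin.last (n + 1))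
  obtain ⟨G, _, p₁, p₂, hG⟩ := h.exists_isGoodWitnessSystem (Fin.last n)
    (h.1.1 (Fin.last (n + 1))) (h.1.2.1 (Fin.last (n + 1))) ν
  exact ⟨⟨G, _, p₁, p₂, hG⟩, hG.1.compatibleGroups⟩
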